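/- **Setting.** Let $\mathcal A,\mathcal X,\mathcal S_e,\mathcal S,\mathcal S_d,\mathcal Y,\mathcal Z,\hat{\mathcal S}$ be arbitrary measurable alphabets. For every $n$ let $d_n:\mathcal S^n\times\hat{\mathcal S}^n\to[0,\infty)$ be a measurable distortion function, let $P_{S^n_{e,i}S^n_iS^n_{d,i}|A^n}$ ($i=1,2$) be two state distributions given the action sequence, and let $P_{Y^n_jZ^n_j|X^nS^n}$ ($j=1,2$) be two channels. With weights $\alpha_i,\beta_j\ge 0$, $\alpha_1+\alpha_2=\beta_1+\beta_2=1$, the mixed states and the mixed channel are $$P_{S^n_eS^nS^n_d|A^n}=\sum_{i=1}^2\alpha_iP_{S^n_{e,i}S^n_iS^n_{d,i}|A^n},\qquad P_{Y^nZ^n|X^nS^n}=\sum_{j=1}^2\beta_jP_{Y^n_jZ^n_j|X^nS^n}.$$ A *process* is given by an auxiliary alphabet $\mathcal U$ and, for each $n$, laws $P_{A^n}$, $P_{U^n|A^nS_e^n}$, $P_{X^n|U^nS_e^n}$ and a measurable estimator $\hat S^n=g_n(X^n,A^n,S_e^n,Z^n)$; the joint law is $P_{A^n}P_{S^n_eS^nS^n_d|A^n}P_{U^n|A^nS^n_e}P_{X^n|U^nS^n_e}P_{Y^nZ^n|X^nS^n}$.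 Using the same inputs with the $i$-th state distribution and the $j$-th channel in place of the mixtures gives the component process $(\boldsymbol A,\boldsymbol U_i,\boldsymbol X_i,\boldsymbol S_{e,i},\boldsymbol S_i,\boldsymbol S_{d,i},\boldsymbol Y_{i,j},\boldsymbol Z_{i,j},\hat{\boldsymbol S}_{i,j})$. Write $$D(\boldsymbol S,\hat{\boldsymbol S})=\limsup_{n\to\infty}\tfrac1n\mathbb E[d_n(S^n,\hat S^n)],$$ and let $$\underline I(\boldsymbol A,\boldsymbol U;\boldsymbol S_d,\boldsymbol Y)=\text{p-}\liminf_{n\to\infty}\tfrac1n\log\frac{P_{Y^nS_d^n|A^nU^n}}{P_{Y^nS_d^n}},\qquad \overline I(\boldsymbol U;\boldsymbol S_e|\boldsymbol A)=\text{p-}\limsup_{n\to\infty}\tfrac1n\log\frac{P_{U^n|A^nS_e^n}}{P_{U^n|A^n}}$$ be the spectral inf-mutual information rate and the spectral sup-conditional mutual information rate. For real $C$ let $$D_a(C)=\sup\{D(\boldsymbol S,\hat{\boldsymbol S}) : \underline I(\boldsymbol A,\boldsymbol U;\boldsymbol Y,\boldsymbol S_d)-\overline I(\boldsymbol U;\boldsymbol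 S_e|\boldsymbol A)\le C\}$$ be the distortion-capacity function of the mixed model (supremum over all processes). **Theorem 4.** For every real $C$, $$D_a(C)\le B(C):=\sup\ \sum_{i=1}^2\sum_{j=1}^2\alpha_i\beta_jD(\boldsymbol S_i,\hat{\boldsymbol S}_{i,j}),$$ where the supremum is over all processes with $$\min_{i,j\in\{1,2\}}\underline I(\boldsymbol A,\boldsymbol U_i;\boldsymbol S_{d,i},\boldsymbol Y_{i,j})-\max_{i\in\{1,2\}}\overline I(\boldsymbol U_i;\boldsymbol S_{e,i}|\boldsymbol A)\le C.$$ The same bound holds for the distortion-capacity function defined through codes: for every $C\ge0$ such that $(C,D)$ is average-achievable on the mixed model for some finite $D$, $\inf\{D:(C,D)\text{ is average-achievable}\}\le B(C)$. Here $(C,D)$ is average-achievable if for every $\epsilon>0$ there are codes of length $n=1,2,\dots$ (action encoder $a^n(m)$, message encoder $x^n(m,s_e^n)$, decoder $\hat m(y^n,s_d^n)$, and estimator $\hat s^n=g_n(x^n,a^n,s_e^n,z^n)$, with a uniformly distributed message $m\in\mathcal M_n$) with $\liminf\frac1n\log|\mathcal M_n|\ge C$, limsup of the average decoding error probability at most $\epsilon$,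 and $\limsup\frac1n\mathbb E[d_n(S^n,\hat S^n)]\le D$. -/

import Mathlib

open MeasureTheory ProbabilityTheory Filter
open scoped NNReal ENNReal Topology

universe u

noncomputable section

namespace ISAC

/-! ### Information-spectrum quantities -/

section Spectrum

/-- `p-limsup Z_n = inf {a | Pr{Z_n > a} → 0}`, where `Z_n` is a random variable on its own
probability space `(Ω n, μ n)`; values in the extended reals. -/
def pLimsup {Ω : ℕ → Type u} [∀ n, MeasurableSpace (Ω n)] (μ : ∀ n, Measure (Ω n))
    (Z : ∀ n, Ω n → EReal) : EReal :=
  sInf {a : EReal | Tendsto (fun n => μ n {ω | a < Z n ω}) atTop (𝓝 0)}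

/-- `p-liminf Z_n = sup {b | Pr{Z_n < b} → 0}`. -/
def pLiminf {Ω : ℕ → Type u} [∀ n, MeasurableSpace (Ω n)] (μ : ∀ n, Measure (Ω n))
    (Z : ∀ n, Ω n → EReal) : EReal :=
  sSup {b : EReal | Tendsto (fun n => μ n {ω | Z n ω < b}) atTop (𝓝 0)}

/-- Likelihood ratio `dμ/dν` of two finite measures with values in `[0, ∞]`. It is the
Radon-Nikodym derivative `ν`-almost everywhere, and equals `∞` on the part of `μ` which is
singular to `ν` (so nothing is lost when `μ` is not absolutely continuous). -/
def likelihoodRatio {Ω : Type u} [MeasurableSpace Ω] (μ ν : Measure Ω) (ω : Ω) : ℝ≥0∞ :=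
  μ.rnDeriv (μ + ν) ω / ν.rnDeriv (μ + ν) ω

/-- Information density `log (dP_{XY} / d(P_X × P_Y)) = log (P_{Y|X}(y|x) / P_Y(y))` of a joint
law on `α × β`. -/
def infoDensity {α β : Type u} [MeasurableSpace α] [MeasurableSpace β]
    (P : Measure (α × β)) (q : α × β) : EReal :=
  ENNReal.log (likelihoodRatio P (P.fst.prod P.snd) q)

/-- Conditional information density
`log (P_{XY|A} / (P_{X|A} P_{Y|A})) = log (P_{Y|AX}(y|a,x) / P_{Y|A}(y|a))`,
for `A` with law `μ` and `(X, Y)` with conditional law `κ` given `A`. -/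
def condInfoDensity {α β γ : Type u} [MeasurableSpace α] [MeasurableSpace β] [MeasurableSpace γ]
    (μ : Measure α) (κ : Kernel α (β × γ)) (q : α × β × γ) : EReal :=
  ENNReal.log (likelihoodRatio (μ ⊗ₘ κ) (μ ⊗ₘ (κ.fst ×ₖ κ.snd)) q)

/-- Spectral inf-mutual information rate of the general pair with joint laws `P n`. -/
def infMutualInfoRate {α β : ℕ → Type u} [∀ n, MeasurableSpace (α n)]
    [∀ n, MeasurableSpace (β n)] (P : ∀ n, Measure (α n × β n)) : EReal :=
  pLiminf P fun n q => ((1 / n : ℝ) : EReal) * infoDensity (P n) q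

/-- Spectral sup-conditional mutual information rate of `(X, Y)` given `A`, where `A^n` has law
`μ n` and `(X^n, Y^n)` has conditional law `κ n` given `A^n`. -/
def supCondMutualInfoRate {α β γ : ℕ → Type u} [∀ n, MeasurableSpace (α n)]
    [∀ n, MeasurableSpace (β n)] [∀ n, MeasurableSpace (γ n)]
    (μ : ∀ n, Measure (α n)) (κ : ∀ n, Kernel (α n) (β n × γ n)) : EReal :=
  pLimsup (fun n => μ n ⊗ₘ κ n) fun n q =>
    ((1 / n : ℝ) : EReal) * condInfoDensity (μ n) (κ n) q

end Spectrum

/-! ### Mixtures of two kernels -/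

/-- The convex combination `w 0 • κ 0 + w 1 • κ 1` of two kernels. -/
def mix {α β : Type u} [MeasurableSpace α] [MeasurableSpace β] (w : Fin 2 → ℝ≥0)
    (κ : Fin 2 → Kernel α β) : Kernel α β where
  toFun a := ∑ i, (w i : ℝ≥0∞) • κ i a
  measurable' := by
    refine Measure.measurable_of_measurable_coe _ fun s hs => ?_
    simp only [Measure.coe_finsetSum, Finset.sum_apply, Measure.smul_apply, smul_eq_mul]
    exact Finset.measurable_sum _ fun i _ => ((κ i).measurable_coe hs).const_mul _

theorem isMarkovKernel_mix {α β : Type u} [MeasurableSpace α] [MeasurableSpace β]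
    {w : Fin 2 → ℝ≥0} (hw : w 0 + w 1 = 1) (κ : Fin 2 → Kernel α β)
    [∀ i, IsMarkovKernel (κ i)] : IsMarkovKernel (mix w κ) := by
  refine ⟨fun a => ⟨?_⟩⟩
  change (∑ i, (w i : ℝ≥0∞) • κ i a) Set.univ = 1
  rw [Fin.sum_univ_two, Measure.add_apply, Measure.smul_apply, Measure.smul_apply, measure_univ,
    measure_univ, smul_eq_mul, smul_eq_mul, mul_one, mul_one]
  exact_mod_cast hw

/-! ### The action-dependent model -/

/-- Sequences of length `n` over an alphabet. -/
abbrev Seq (n : ℕ) (𝒳 : Type u) : Type u := Fin n → 𝒳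

/-- State distribution: for every `n`, the conditional law `P_{S_e^n S^n S_d^n | A^n}`. -/
abbrev StateLaw (𝒜 𝒮e 𝒮 𝒮d : Type u) [MeasurableSpace 𝒜] [MeasurableSpace 𝒮e]
    [MeasurableSpace 𝒮] [MeasurableSpace 𝒮d] : Type u :=
  ∀ n : ℕ, Kernel (Seq n 𝒜) (Seq n 𝒮e × Seq n 𝒮 × Seq n 𝒮d)

/-- General channel: for every `n`, the conditional law `P_{Y^n Z^n | X^n S^n}`. -/
abbrev Channel (𝒳 𝒮 𝒴 𝒵 : Type u) [MeasurableSpace 𝒳] [MeasurableSpace 𝒮]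
    [MeasurableSpace 𝒴] [MeasurableSpace 𝒵] : Type u :=
  ∀ n : ℕ, Kernel (Seq n 𝒳 × Seq n 𝒮) (Seq n 𝒴 × Seq n 𝒵)

/-- What is chosen freely in a process `(A, U, X, S_e, S, S_d, Y, Z, Ŝ)`: the auxiliary alphabet
`𝒰`, the laws `P_{A^n}`, `P_{U^n | A^n S_e^n}`, `P_{X^n | U^n S_e^n}` and the estimators `g_n`,
with `Ŝ^n = g_n (X^n, A^n, S_e^n, Z^n)`. -/
structure InputProcess (𝒜 𝒳 𝒮e 𝒵 𝒮hat : Type u) [MeasurableSpace 𝒜] [MeasurableSpace 𝒳]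
    [MeasurableSpace 𝒮e] [MeasurableSpace 𝒵] [MeasurableSpace 𝒮hat] where
  𝒰 : Type u
  [measurableSpaceU : MeasurableSpace 𝒰]
  lawA : ∀ n : ℕ, Measure (Seq n 𝒜)
  lawU : ∀ n : ℕ, Kernel (Seq n 𝒜 × Seq n 𝒮e) (Seq n 𝒰)
  lawX : ∀ n : ℕ, Kernel (Seq n 𝒰 × Seq n 𝒮e) (Seq n 𝒳)
  g : ∀ n : ℕ, Seq n 𝒳 × Seq n 𝒜 × Seq n 𝒮e × Seq n 𝒵 → Seq n 𝒮hat
  [isProbabilityMeasure_lawA : ∀ n, IsProbabilityMeasure (lawA n)]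
  [isMarkovKernel_lawU : ∀ n, IsMarkovKernel (lawU n)]
  [isMarkovKernel_lawX : ∀ n, IsMarkovKernel (lawX n)]
  measurable_g : ∀ n, Measurable (g n)

attribute [instance] InputProcess.measurableSpaceU InputProcess.isProbabilityMeasure_lawA
  InputProcess.isMarkovKernel_lawU InputProcess.isMarkovKernel_lawX

variable {𝒜 𝒳 𝒮e 𝒮 𝒮d 𝒴 𝒵 𝒮hat : Type u}
  [MeasurableSpace 𝒜] [MeasurableSpace 𝒳] [MeasurableSpace 𝒮e] [MeasurableSpace 𝒮]
  [MeasurableSpace 𝒮d] [MeasurableSpace 𝒴] [MeasurableSpace 𝒵] [MeasurableSpace 𝒮hat]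

namespace InputProcess

/-- Sample space of `(A^n, S_e^n, S^n, S_d^n, U^n, X^n, Y^n, Z^n)`, nested in the order in which
the variables are generated. -/
abbrev Outcome (p : InputProcess 𝒜 𝒳 𝒮e 𝒵 𝒮hat) (𝒮 𝒮d 𝒴 : Type u) (n : ℕ) : Type u :=
  Seq n 𝒜 × (((Seq n 𝒮e × Seq n 𝒮 × Seq n 𝒮d) × Seq n p.𝒰) × Seq n 𝒳) × (Seq n 𝒴 × Seq n 𝒵)

/-- The joint law
`P_{A^n} P_{S_e^n S^n S_d^n|A^n} P_{U^n|A^n S_e^n} P_{X^n|U^n S_e^n} P_{Y^n Z^n|X^n S^n}`. -/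
def jointLaw (p : InputProcess 𝒜 𝒳 𝒮e 𝒵 𝒮hat) (Q : StateLaw 𝒜 𝒮e 𝒮 𝒮d)
    (W : Channel 𝒳 𝒮 𝒴 𝒵) (n : ℕ) : Measure (p.Outcome 𝒮 𝒮d 𝒴 n) :=
  p.lawA n ⊗ₘ
    (((Q n
      ⊗ₖ (p.lawU n).comap
        (fun q : Seq n 𝒜 × (Seq n 𝒮e × Seq n 𝒮 × Seq n 𝒮d) => (q.1, q.2.1)) (by fun_prop))
      ⊗ₖ (p.lawX n).comap
        (fun q : Seq n 𝒜 × ((Seq n 𝒮e × Seq n 𝒮 × Seq n 𝒮d) × Seq n p.𝒰) => (q.2.2, q.2.1.1))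
        (by fun_prop))
      ⊗ₖ (W n).comap
        (fun q : Seq n 𝒜 × (((Seq n 𝒮e × Seq n 𝒮 × Seq n 𝒮d) × Seq n p.𝒰) × Seq n 𝒳) =>
          (q.2.2, q.2.1.1.2.1))
        (by fun_prop))

/-- The joint law of `((A^n, U^n), (S_d^n, Y^n))`. -/
def lawAUSdY (p : InputProcess 𝒜 𝒳 𝒮e 𝒵 𝒮hat) (Q : StateLaw 𝒜 𝒮e 𝒮 𝒮d)
    (W : Channel 𝒳 𝒮 𝒴 𝒵) (n : ℕ) :
    Measure ((Seq n 𝒜 × Seq n p.𝒰) × (Seq n 𝒮d × Seq n 𝒴)) :=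
  (p.jointLaw Q W n).map fun ω => ((ω.1, ω.2.1.1.2), (ω.2.1.1.1.2.2, ω.2.2.1))

/-- The conditional law of `(S_e^n, U^n)` given `A^n`, namely `P_{S_e^n|A^n} P_{U^n|A^n S_e^n}`. -/
def condLawSeU (p : InputProcess 𝒜 𝒳 𝒮e 𝒵 𝒮hat) (Q : StateLaw 𝒜 𝒮e 𝒮 𝒮d) (n : ℕ) :
    Kernel (Seq n 𝒜) (Seq n 𝒮e × Seq n p.𝒰) :=
  (Q n).fst ⊗ₖ p.lawU n

/-- The spectral inf-mutual information rate `I̲(A, U; S_d, Y)`. -/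
def infRate (p : InputProcess 𝒜 𝒳 𝒮e 𝒵 𝒮hat) (Q : StateLaw 𝒜 𝒮e 𝒮 𝒮d)
    (W : Channel 𝒳 𝒮 𝒴 𝒵) : EReal :=
  infMutualInfoRate (p.lawAUSdY Q W)

/-- The spectral sup-conditional mutual information rate `Ī(U; S_e | A)`. -/
def supRate (p : InputProcess 𝒜 𝒳 𝒮e 𝒵 𝒮hat) (Q : StateLaw 𝒜 𝒮e 𝒮 𝒮d) : EReal :=
  supCondMutualInfoRate p.lawA (p.condLawSeU Q)

/-- The average distortion `D(S, Ŝ) = limsup (1/n) E[d_n(S^n, g_n(X^n, A^n, S_e^n, Z^n))]`. -/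
def avgDistortion (p : InputProcess 𝒜 𝒳 𝒮e 𝒵 𝒮hat) (d : ∀ n, Seq n 𝒮 × Seq n 𝒮hat → ℝ≥0)
    (Q : StateLaw 𝒜 𝒮e 𝒮 𝒮d) (W : Channel 𝒳 𝒮 𝒴 𝒵) : ℝ≥0∞ :=
  limsup (fun n : ℕ =>
    (∫⁻ ω, (d n (ω.2.1.1.1.2.1, p.g n (ω.2.1.2, ω.1, ω.2.1.1.1.1, ω.2.2.2)) : ℝ≥0∞)
      ∂(p.jointLaw Q W n)) / n) atTop

end InputProcess

/-- The distortion-capacity function in its information-spectrum form: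
`D_a(C) = sup D(S, Ŝ)` over processes with `I̲(A, U; Y, S_d) - Ī(U; S_e | A) ≤ C`. -/
def distortionCapacity (d : ∀ n, Seq n 𝒮 × Seq n 𝒮hat → ℝ≥0)
    (Q : StateLaw 𝒜 𝒮e 𝒮 𝒮d) (W : Channel 𝒳 𝒮 𝒴 𝒵) (C : ℝ) : ℝ≥0∞ :=
  ⨆ (p : InputProcess 𝒜 𝒳 𝒮e 𝒵 𝒮hat) (_ : p.infRate Q W - p.supRate Q ≤ (C : EReal)),
    p.avgDistortion d Q W

/-- The bound for mixed states and channels: the supremum of `∑ α_i β_j D(S_i, Ŝ_{i,j})` over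
processes with `min_{i,j} I̲(A, U_i; S_{d,i}, Y_{i,j}) - max_i Ī(U_i; S_{e,i} | A) ≤ C`. -/
def mixedDistortionBound (d : ∀ n, Seq n 𝒮 × Seq n 𝒮hat → ℝ≥0) (α β : Fin 2 → ℝ≥0)
    (Q : Fin 2 → StateLaw 𝒜 𝒮e 𝒮 𝒮d) (W : Fin 2 → Channel 𝒳 𝒮 𝒴 𝒵) (C : ℝ) : ℝ≥0∞ :=
  ⨆ (p : InputProcess 𝒜 𝒳 𝒮e 𝒵 𝒮hat)
    (_ : (⨅ i, ⨅ j, p.infRate (Q i) (W j)) - (⨆ i, p.supRate (Q i)) ≤ (C : EReal)),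
    ∑ i, ∑ j, (α i : ℝ≥0∞) * (β j : ℝ≥0∞) * p.avgDistortion d (Q i) (W j)

/-! ### Codes and the operational distortion-capacity function -/

/-- A code of block length `n` with message set `Fin M`. -/
structure Code (𝒜 𝒳 𝒮e 𝒮d 𝒴 𝒵 𝒮hat : Type u) [MeasurableSpace 𝒜] [MeasurableSpace 𝒳]
    [MeasurableSpace 𝒮e] [MeasurableSpace 𝒮d] [MeasurableSpace 𝒴] [MeasurableSpace 𝒵]
    [MeasurableSpace 𝒮hat] (n : ℕ) where
  M : ℕ
  M_pos : 0 < M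
  fA : Fin M → Seq n 𝒜
  f : Fin M → Seq n 𝒮e → Seq n 𝒳
  h : Seq n 𝒴 × Seq n 𝒮d → Fin M
  g : Seq n 𝒳 × Seq n 𝒜 × Seq n 𝒮e × Seq n 𝒵 → Seq n 𝒮hat
  measurable_f : ∀ m, Measurable (f m)
  measurable_h : Measurable h
  measurable_g : Measurable g

namespace Code

variable {n : ℕ}

/-- Average decoding error probability, for a uniformly distributed message. -/
def errorProb (c : Code 𝒜 𝒳 𝒮e 𝒮d 𝒴 𝒵 𝒮hat n) (Q : StateLaw 𝒜 𝒮e 𝒮 𝒮d)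
    (W : Channel 𝒳 𝒮 𝒴 𝒵) : ℝ≥0∞ :=
  (∑ m, ∫⁻ s, W n (c.f m s.1, s.2.1) {y | c.h (y.1, s.2.2) ≠ m} ∂(Q n (c.fA m))) / c.M

/-- Expected (unnormalized) distortion `E[d_n(S^n, g_n(f(M, S_e^n), f_A(M), S_e^n, Z^n))]`. -/
def expectedDistortion (c : Code 𝒜 𝒳 𝒮e 𝒮d 𝒴 𝒵 𝒮hat n)
    (d : ∀ n, Seq n 𝒮 × Seq n 𝒮hat → ℝ≥0) (Q : StateLaw 𝒜 𝒮e 𝒮 𝒮d)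
    (W : Channel 𝒳 𝒮 𝒴 𝒵) : ℝ≥0∞ :=
  (∑ m, ∫⁻ s, ∫⁻ y, (d n (s.2.1, c.g (c.f m s.1, c.fA m, s.1, y.2)) : ℝ≥0∞)
    ∂(W n (c.f m s.1, s.2.1)) ∂(Q n (c.fA m))) / c.M

end Code

/-- The pair `(R, D)` is average-achievable. -/
def AverageAchievable (d : ∀ n, Seq n 𝒮 × Seq n 𝒮hat → ℝ≥0) (Q : StateLaw 𝒜 𝒮e 𝒮 𝒮d)
    (W : Channel 𝒳 𝒮 𝒴 𝒵) (R : ℝ) (D : ℝ≥0) : Prop :=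
  ∀ ε : ℝ, 0 < ε → ∃ c : ∀ n, Code 𝒜 𝒳 𝒮e 𝒮d 𝒴 𝒵 𝒮hat n,
    (R : EReal) ≤ liminf (fun n : ℕ => ((Real.log (c n).M / n : ℝ) : EReal)) atTop ∧
    limsup (fun n : ℕ => (c n).errorProb Q W) atTop ≤ ENNReal.ofReal ε ∧
    limsup (fun n : ℕ => (c n).expectedDistortion d Q W / n) atTop ≤ (D : ℝ≥0∞)

/-- The operational distortion-capacity function: the smallest average distortion (an infimum)
that is achievable at rate `C`; it is `∞` if there is none. -/
def operationalDistortion (d : ∀ n, Seq n 𝒮 × Seq n 𝒮hat → ℝ≥0) (Q : StateLaw 𝒜 𝒮e 𝒮 𝒮d)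
    (W : Channel 𝒳 𝒮 𝒴 𝒵) (C : ℝ) : ℝ≥0∞ :=
  ⨅ (D : ℝ≥0) (_ : AverageAchievable d Q W C D), (D : ℝ≥0∞)

end ISAC

end

/-!
Let a law `P` dominate `w • P'` with `w > 0`. With probability close to one under `P'`, the
marginals of `P` have density at most `K` with respect to those of `P'`, by Markov's inequality;
off that event the likelihood ratio of `P` against the product of its marginals is at least
`w / K²` times that of `P'`. A subexponential factor is invisible to the spectral rates, so the
inf-mutual information rate of a mixture is at least the smallest one among its components. For the
sup-conditional rate no exceptional event is needed: the numerator of `P_{U|A,S_e} / P_{U|A}` is the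
same for the mixture and its components, and its denominator dominates `w • P'_{U|A}`. A process of
rate at most `C` on the mixed model is thus admissible in the bound, and its distortion is
controlled by the subadditivity of the limsup.

For codes, send in every block the message of largest expected distortion. This is a process which
carries no information, hence of rate at most `0 ≤ C`, and its distortion is at least the average
one.
-/

namespace ISAC

section Mixture

variable {α β γ ι ι' : Type*} [MeasurableSpace α] [MeasurableSpace β] [MeasurableSpace γ]
  [Fintype ι] [Fintype ι']

/-- The kernel `κ'` is the mixture of the kernels `κ i` with weights `w i`. This extends `mix` to
finite families; being a predicate, it does not require the weights to sum to one. -/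
def IsMixture (w : ι → ℝ≥0) (κ : ι → Kernel α β) (κ' : Kernel α β) : Prop :=
  ∀ a, κ' a = ∑ i, (w i : ℝ≥0∞) • κ i a

theorem smul_le_sum_smul (w : ι → ℝ≥0) (μ : ι → Measure α) (i : ι) :
    (w i : ℝ≥0∞) • μ i ≤ ∑ i, (w i : ℝ≥0∞) • μ i :=
  Finset.single_le_sum (f := fun i => (w i : ℝ≥0∞) • μ i) (fun _ _ => Measure.zero_le _)
    (Finset.mem_univ i)

namespace IsMixture

variable {w : ι → ℝ≥0} {κ : ι → Kernel α β} {κ' : Kernel α β}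

theorem smul_le (h : IsMixture w κ κ') (i : ι) (a : α) : (w i : ℝ≥0∞) • κ i a ≤ κ' a :=
  h a ▸ smul_le_sum_smul w (fun i => κ i a) i

theorem comap (h : IsMixture w κ κ') {f : γ → α} (hf : Measurable f) :
    IsMixture w (fun i => (κ i).comap f hf) (κ'.comap f hf) :=
  fun c => h (f c)

theorem fst {κ : ι → Kernel α (β × γ)} {κ' : Kernel α (β × γ)} (h : IsMixture w κ κ') :
    IsMixture w (fun i => (κ i).fst) κ'.fst := fun a => by
  ext s hs
  simp only [Measure.finsetSum_apply, Measure.smul_apply, Kernel.fst_apply' _ _ hs, h a]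

theorem measure_compProd (h : IsMixture w κ κ') (μ : Measure α) [SFinite μ]
    [IsSFiniteKernel κ'] [∀ i, IsSFiniteKernel (κ i)] :
    μ ⊗ₘ κ' = ∑ i, (w i : ℝ≥0∞) • (μ ⊗ₘ κ i) := by
  ext s hs
  have hm : ∀ i, Measurable fun a => κ i a (Prod.mk a ⁻¹' s) := fun i =>
    Kernel.measurable_kernel_prodMk_left hs
  simp_rw [Measure.finsetSum_apply, Measure.smul_apply, Measure.compProd_apply hs, h _,
    Measure.finsetSum_apply, Measure.smul_apply, smul_eq_mul]
  rw [lintegral_finsetSum _ fun i _ => (hm i).const_mul _]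
  exact Finset.sum_congr rfl fun i _ => lintegral_const_mul _ (hm i)

theorem compProd_right (h : IsMixture w κ κ') [IsSFiniteKernel κ'] [∀ i, IsSFiniteKernel (κ i)]
    (η : Kernel (α × β) γ) [IsSFiniteKernel η] :
    IsMixture w (fun i => κ i ⊗ₖ η) (κ' ⊗ₖ η) := fun a => by
  ext s hs
  simp_rw [Measure.finsetSum_apply, Measure.smul_apply, Kernel.compProd_apply hs, h a,
    lintegral_finsetSum_measure, lintegral_smul_measure]

theorem compProd (h : IsMixture w κ κ') [IsSFiniteKernel κ'] [∀ i, IsSFiniteKernel (κ i)]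
    {v : ι' → ℝ≥0} {η : ι' → Kernel (α × β) γ} {η' : Kernel (α × β) γ} (hη : IsMixture v η η')
    [IsSFiniteKernel η'] [∀ j, IsSFiniteKernel (η j)] :
    IsMixture (fun k : ι × ι' => w k.1 * v k.2) (fun k => κ k.1 ⊗ₖ η k.2) (κ' ⊗ₖ η') := fun a => by
  ext s hs
  have hm : ∀ j, Measurable fun b => η j (a, b) (Prod.mk b ⁻¹' s) := fun j =>
    Kernel.measurable_kernel_prodMk_left' hs a
  simp_rw [h.compProd_right η' a, Measure.finsetSum_apply, Measure.smul_apply,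
    Kernel.compProd_apply hs, hη _, Measure.finsetSum_apply, Measure.smul_apply, smul_eq_mul,
    lintegral_finsetSum _ fun j _ => (hm j).const_mul _, lintegral_const_mul _ (hm _),
    Finset.mul_sum, Fintype.sum_prod_type, ENNReal.coe_mul, mul_assoc]

end IsMixture

end Mixture

section LikelihoodRatio

variable {Ω : Type u} [MeasurableSpace Ω]

theorem measurable_likelihoodRatio (μ ν : Measure Ω) : Measurable (likelihoodRatio μ ν) :=
  (Measure.measurable_rnDeriv _ _).div (Measure.measurable_rnDeriv _ _)

theorem restrict_le_smul_restrict (μ ν : Measure Ω) [IsFiniteMeasure μ] [IsFiniteMeasure ν]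
    {c : ℝ≥0∞} (hc : c ≠ ∞) {s : Set Ω} (hs : MeasurableSet s)
    (h : ∀ ω ∈ s, likelihoodRatio μ ν ω ≤ c) : μ.restrict s ≤ c • ν.restrict s := by
  have hμ : μ ≪ μ + ν := (Measure.le_add_right le_rfl).absolutelyContinuous
  have hν : ν ≪ μ + ν := (Measure.le_add_left le_rfl).absolutelyContinuous
  refine Measure.le_iff.2 fun t ht => ?_
  rw [Measure.smul_apply, Measure.restrict_apply ht, Measure.restrict_apply ht, smul_eq_mul,
    ← Measure.setLIntegral_rnDeriv hμ, ← Measure.setLIntegral_rnDeriv hν,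
    ← lintegral_const_mul _ (Measure.measurable_rnDeriv _ _)]
  refine lintegral_mono_ae ?_
  filter_upwards [ae_restrict_mem (ht.inter hs), ae_restrict_of_ae (Measure.rnDeriv_lt_top ν _)]
    with ω hω hfin
  exact (ENNReal.div_le_iff_le_mul (.inr hc) (.inl hfin.ne)).1 (h ω hω.2)

theorem smul_restrict_le_restrict (μ ν : Measure Ω) [IsFiniteMeasure μ] [IsFiniteMeasure ν]
    {c : ℝ≥0∞} {s : Set Ω} (hs : MeasurableSet s) (h : ∀ ω ∈ s, c ≤ likelihoodRatio μ ν ω) :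
    c • ν.restrict s ≤ μ.restrict s := by
  have hμ : μ ≪ μ + ν := (Measure.le_add_right le_rfl).absolutelyContinuous
  have hν : ν ≪ μ + ν := (Measure.le_add_left le_rfl).absolutelyContinuous
  refine Measure.le_iff.2 fun t ht => ?_
  rw [Measure.smul_apply, Measure.restrict_apply ht, Measure.restrict_apply ht, smul_eq_mul,
    ← Measure.setLIntegral_rnDeriv hμ, ← Measure.setLIntegral_rnDeriv hν,
    ← lintegral_const_mul _ (Measure.measurable_rnDeriv _ _)]
  exact setLIntegral_mono' (ht.inter hs) fun ω hω => ENNReal.mul_le_of_le_div (h ω hω.2)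

theorem measure_le_mul_of_likelihoodRatio_le (μ ν : Measure Ω) [IsFiniteMeasure μ]
    [IsFiniteMeasure ν] {c : ℝ≥0∞} (hc : c ≠ ∞) {s : Set Ω} (hs : MeasurableSet s)
    (h : ∀ ω ∈ s, likelihoodRatio μ ν ω ≤ c) : μ s ≤ c * ν s := by
  simpa using restrict_le_smul_restrict μ ν hc hs h s

theorem mul_measure_le_of_le_likelihoodRatio (μ ν : Measure Ω) [IsFiniteMeasure μ]
    [IsFiniteMeasure ν] {c : ℝ≥0∞} {s : Set Ω} (hs : MeasurableSet s)
    (h : ∀ ω ∈ s, c ≤ likelihoodRatio μ ν ω) : c * ν s ≤ μ s := by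
  simpa using smul_restrict_le_restrict μ ν hs h s

theorem measure_lt_likelihoodRatio_le_inv (μ ν : Measure Ω) [IsProbabilityMeasure μ]
    [IsFiniteMeasure ν] (c : ℝ≥0∞) : ν {ω | c < likelihoodRatio μ ν ω} ≤ c⁻¹ := by
  rw [ENNReal.le_inv_iff_mul_le, mul_comm]
  exact (mul_measure_le_of_le_likelihoodRatio μ ν
    (measurable_likelihoodRatio μ ν measurableSet_Ioi) fun _ hω => le_of_lt hω).trans prob_le_one

theorem likelihoodRatio_self_ae_eq_one (μ : Measure Ω) [IsFiniteMeasure μ] :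
    ∀ᵐ ω ∂μ, likelihoodRatio μ μ ω = 1 := by
  have hμ : μ ≪ μ + μ := (Measure.le_add_right le_rfl).absolutelyContinuous
  filter_upwards [Measure.rnDeriv_pos hμ, hμ.ae_le (Measure.rnDeriv_lt_top μ (μ + μ))]
    with ω hpos hfin
  exact ENNReal.div_self hpos.ne' hfin.ne

theorem measure_eq_zero_of_mul_le_mul {μ : Measure Ω} [IsFiniteMeasure μ] {a b : ℝ≥0∞}
    (hab : a < b) {s : Set Ω} (h : b * μ s ≤ a * μ s) : μ s = 0 := by
  by_contra h0
  exact ((ENNReal.mul_le_mul_iff_left h0 (measure_ne_top μ s)).1 h).not_gt hab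

theorem measure_likelihoodRatio_lt_le_add {P P' R R' : Measure Ω} [IsFiniteMeasure P]
    [IsFiniteMeasure P'] [IsFiniteMeasure R] [IsFiniteMeasure R'] {w c c' K : ℝ≥0∞} {E : Set Ω}
    (hE : MeasurableSet E) (hP : w • P' ≤ P) (hR : R.restrict E ≤ K • R') (hc : c ≠ ∞)
    (hlt : c * K < w * c') :
    P' {ω | likelihoodRatio P R ω < c} ≤ P' {ω | likelihoodRatio P' R' ω < c'} + P' Eᶜ := by
  set T := {ω | likelihoodRatio P R ω < c}
  set N := {ω | likelihoodRatio P' R' ω < c'}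
  set B := (T \ N) ∩ E
  have hB : MeasurableSet B := ((measurable_likelihoodRatio P R measurableSet_Iio).diff
    (measurable_likelihoodRatio P' R' measurableSet_Iio)).inter hE
  have hnull : P' B = 0 := measure_eq_zero_of_mul_le_mul hlt <| by
    have hRB : R B ≤ K * R' B :=
      (Measure.restrict_eq_self R Set.inter_subset_right).symm.trans_le (hR B)
    have hPB : P B ≤ c * R B :=
      measure_le_mul_of_likelihoodRatio_le P R hc hB fun ω hω => le_of_lt hω.1.1
    have hPB' : c' * R' B ≤ P' B :=
      mul_measure_le_of_le_likelihoodRatio P' R' hB fun ω hω => not_lt.1 hω.1.2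
    calc w * c' * P' B = c' * (w • P') B := by rw [Measure.smul_apply, smul_eq_mul]; ring
      _ ≤ c' * (c * (K * R' B)) := by gcongr; exact (hP B).trans (hPB.trans (by gcongr))
      _ = c * K * (c' * R' B) := by ring
      _ ≤ c * K * P' B := by gcongr
  have hcover : T ⊆ N ∪ Eᶜ ∪ B := fun ω hω => by
    by_cases hN : ω ∈ N <;> by_cases hωE : ω ∈ E <;> simp_all [B]
  calc P' T ≤ P' (N ∪ Eᶜ) + P' B := (measure_mono hcover).trans (measure_union_le _ _)
    _ ≤ P' N + P' Eᶜ := by rw [hnull, add_zero]; exact measure_union_le _ _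

theorem measure_lt_likelihoodRatio_le {P P' R R' : Measure Ω} [IsFiniteMeasure P]
    [IsFiniteMeasure P'] [IsFiniteMeasure R] [IsFiniteMeasure R'] {w c c' : ℝ≥0∞} {h : Ω → ℝ≥0∞}
    (hP : P' = P.withDensity h) (hR : w • R' ≤ R.withDensity h) (hc' : c' ≠ ∞)
    (hlt : c' < c * w) :
    P' {ω | c < likelihoodRatio P R ω} ≤ P' {ω | c' < likelihoodRatio P' R' ω} := by
  set T := {ω | c < likelihoodRatio P R ω}
  set N := {ω | c' < likelihoodRatio P' R' ω}
  set B := T \ N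
  have hB : MeasurableSet B := (measurable_likelihoodRatio P R measurableSet_Ioi).diff
    (measurable_likelihoodRatio P' R' measurableSet_Ioi)
  have hnull : P' B = 0 := measure_eq_zero_of_mul_le_mul hlt <| by
    have hPB : P' B ≤ c' * R' B :=
      measure_le_mul_of_likelihoodRatio_le P' R' hc' hB fun ω hω => not_lt.1 hω.2
    have hPR : c * R.withDensity h B ≤ P' B := by
      rw [hP, withDensity_apply _ hB, withDensity_apply _ hB, ← smul_eq_mul,
        ← lintegral_smul_measure]
      exact lintegral_mono'
        (smul_restrict_le_restrict P R hB fun ω hω => le_of_lt hω.1) le_rfl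
    calc c * w * P' B ≤ c * w * (c' * R' B) := by gcongr
      _ = c' * (c * (w • R') B) := by rw [Measure.smul_apply, smul_eq_mul]; ring
      _ ≤ c' * P' B := by gcongr; exact le_trans (by gcongr) hPR
  calc P' T ≤ P' N + P' B :=
        (measure_mono (by simp [B])).trans (measure_union_le N B)
    _ = P' N := by rw [hnull, add_zero]

end LikelihoodRatio

section Kernel

variable {α β γ : Type*} [MeasurableSpace α] [MeasurableSpace β] [MeasurableSpace γ]

theorem withDensity_compProd (μ : Measure α) [SFinite μ] {f : α → ℝ≥0∞} (hf : Measurable f)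
    (κ : Kernel α β) [IsSFiniteKernel κ] :
    μ.withDensity f ⊗ₘ κ = (μ ⊗ₘ κ).withDensity fun q => f q.1 := by
  refine Measure.ext_of_lintegral _ fun g hg => ?_
  have hf' : Measurable fun q : α × β => f q.1 := hf.comp measurable_fst
  rw [Measure.lintegral_compProd hg, lintegral_withDensity_eq_lintegral_mul _ hf
      hg.lintegral_kernel_prod_right', lintegral_withDensity_eq_lintegral_mul _ hf' hg,
    Measure.lintegral_compProd (hf'.mul hg)]
  refine lintegral_congr fun a => ?_
  exact (lintegral_const_mul _ (hg.comp measurable_prodMk_left)).symm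

theorem compProd_compProd_eq_withDensity {μ : Measure α} [SFinite μ] {κ κ' : Kernel α β}
    [IsSFiniteKernel κ] [IsSFiniteKernel κ'] {f : α × β → ℝ≥0∞} (hf : Measurable f)
    (h : μ ⊗ₘ κ' = (μ ⊗ₘ κ).withDensity f) (η : Kernel (α × β) γ) [IsSFiniteKernel η] :
    μ ⊗ₘ (κ' ⊗ₖ η) = (μ ⊗ₘ (κ ⊗ₖ η)).withDensity fun q => f (q.1, q.2.1) := by
  rw [← Measure.compProd_assoc', ← Measure.compProd_assoc', h, withDensity_compProd _ hf]
  have hf' : Measurable fun q : α × β × γ => f (q.1, q.2.1) := hf.comp (by fun_prop)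
  ext s hs
  rw [Measure.map_apply MeasurableEquiv.prodAssoc.measurable hs,
    withDensity_apply _ (MeasurableEquiv.prodAssoc.measurable hs), withDensity_apply _ hs,
    setLIntegral_map hs hf' MeasurableEquiv.prodAssoc.measurable]
  rfl

theorem prod_eq_compProd_prodMkRight (κ : Kernel α β) [IsSFiniteKernel κ] (η : Kernel α γ)
    [IsSFiniteKernel η] : κ ×ₖ η = κ ⊗ₖ Kernel.prodMkRight β η := by
  ext a s hs
  rw [Kernel.prod_apply' _ _ _ hs, Kernel.compProd_apply hs]
  rfl

theorem dirac_compProd_eq_map (a : α) (κ : Kernel α β) [IsSFiniteKernel κ] :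
    Measure.dirac a ⊗ₘ κ = (κ a).map (Prod.mk a) :=
  Measure.ext_of_lintegral _ fun f hf => by
    rw [Measure.lintegral_compProd hf, lintegral_dirac' _ hf.lintegral_kernel_prod_right',
      lintegral_map hf measurable_prodMk_left]

theorem eq_of_isProbabilityMeasure_of_subsingleton [Subsingleton α]
    (μ ν : Measure α) [IsProbabilityMeasure μ] [IsProbabilityMeasure ν] : μ = ν := by
  ext s -
  rcases s.eq_empty_or_nonempty with rfl | hs
  · rw [measure_empty, measure_empty]
  · rw [hs.eq_univ, measure_univ, measure_univ]

end Kernel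

section InformationDensity

variable {α β γ : Type u} [MeasurableSpace α] [MeasurableSpace β] [MeasurableSpace γ]

theorem measure_likelihoodRatio_prod_lt_le (P P' : Measure (α × β)) [IsProbabilityMeasure P]
    [IsProbabilityMeasure P'] {w c c' K : ℝ≥0∞} (hP : w • P' ≤ P) (hc : c ≠ ∞) (hK : K ≠ ∞)
    (hlt : c * (K * K) < w * c') :
    P' {q | likelihoodRatio P (P.fst.prod P.snd) q < c} ≤
      P' {q | likelihoodRatio P' (P'.fst.prod P'.snd) q < c'} + (K⁻¹ + K⁻¹) := by
  set E₁ := {a | likelihoodRatio P.fst P'.fst a ≤ K}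
  set E₂ := {b | likelihoodRatio P.snd P'.snd b ≤ K}
  have hE₁ : MeasurableSet E₁ := measurable_likelihoodRatio _ _ measurableSet_Iic
  have hE₂ : MeasurableSet E₂ := measurable_likelihoodRatio _ _ measurableSet_Iic
  have hbad₁ : P' (Prod.fst ⁻¹' E₁ᶜ) ≤ K⁻¹ := by
    rw [← Measure.fst_apply hE₁.compl]
    simpa [E₁, Set.compl_ofPred] using measure_lt_likelihoodRatio_le_inv P.fst P'.fst K
  have hbad₂ : P' (Prod.snd ⁻¹' E₂ᶜ) ≤ K⁻¹ := by
    rw [← Measure.snd_apply hE₂.compl]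
    simpa [E₂, Set.compl_ofPred] using measure_lt_likelihoodRatio_le_inv P.snd P'.snd K
  have hprod : (P.fst.prod P.snd).restrict (E₁ ×ˢ E₂) ≤ (K * K) • P'.fst.prod P'.snd := by
    rw [← Measure.prod_restrict, mul_smul, ← Measure.prod_smul_left, ← Measure.prod_smul_right]
    refine Measure.prod_mono ((restrict_le_smul_restrict _ _ hK hE₁ fun a ha => ha).trans ?_)
      ((restrict_le_smul_restrict _ _ hK hE₂ fun b hb => hb).trans ?_)
    all_goals gcongr; exact Measure.restrict_le_self
  have hcompl : (E₁ ×ˢ E₂)ᶜ = Prod.fst ⁻¹' E₁ᶜ ∪ Prod.snd ⁻¹' E₂ᶜ := by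
    rw [Set.prod_eq, Set.compl_inter]; rfl
  refine (measure_likelihoodRatio_lt_le_add (hE₁.prod hE₂) hP hprod hc hlt).trans ?_
  gcongr
  exact hcompl ▸ (measure_union_le _ _).trans (add_le_add hbad₁ hbad₂)

theorem measure_lt_likelihoodRatio_condProd_le (μ : Measure α) [IsProbabilityMeasure μ]
    (κ κ' : Kernel α β) [IsMarkovKernel κ] [IsMarkovKernel κ'] (η : Kernel (α × β) γ)
    [IsMarkovKernel η] {w c c' : ℝ≥0∞} (hw : w ≠ 0) (hκ : ∀ a, w • κ' a ≤ κ a) (hc' : c' ≠ ∞)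
    (hlt : c' < c * w) :
    (μ ⊗ₘ (κ' ⊗ₖ η)) {q | c < likelihoodRatio (μ ⊗ₘ (κ ⊗ₖ η))
        (μ ⊗ₘ ((κ ⊗ₖ η).fst ×ₖ (κ ⊗ₖ η).snd)) q} ≤
      (μ ⊗ₘ (κ' ⊗ₖ η)) {q | c' < likelihoodRatio (μ ⊗ₘ (κ' ⊗ₖ η))
        (μ ⊗ₘ ((κ' ⊗ₖ η).fst ×ₖ (κ' ⊗ₖ η).snd)) q} := by
  have hac : μ ⊗ₘ κ' ≪ μ ⊗ₘ κ := Measure.AbsolutelyContinuous.compProd_right <| .of_forall fun a =>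
    (Measure.absolutelyContinuous_smul hw).trans (hκ a).absolutelyContinuous
  have hsnd : ∀ a, w • (κ' ⊗ₖ η).snd a ≤ (κ ⊗ₖ η).snd a := fun a => Measure.le_iff.2 fun s hs => by
    rw [Measure.smul_apply, Kernel.snd_apply' _ _ hs, Kernel.snd_apply' _ _ hs,
      Kernel.compProd_apply (measurable_snd hs), Kernel.compProd_apply (measurable_snd hs),
      ← lintegral_smul_measure]
    exact lintegral_mono' (hκ a) le_rfl
  have hr : Measurable ((μ ⊗ₘ κ').rnDeriv (μ ⊗ₘ κ)) := Measure.measurable_rnDeriv _ _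
  have hdens := (Measure.withDensity_rnDeriv_eq _ _ hac).symm
  refine measure_lt_likelihoodRatio_le (compProd_compProd_eq_withDensity hr hdens η) ?_ hc' hlt
  rw [Kernel.fst_compProd, Kernel.fst_compProd, prod_eq_compProd_prodMkRight κ,
    ← compProd_compProd_eq_withDensity hr hdens, ← prod_eq_compProd_prodMkRight]
  refine Measure.le_iff.2 fun s hs => ?_
  rw [Measure.smul_apply, smul_eq_mul, Measure.compProd_apply hs, Measure.compProd_apply hs,
    ← lintegral_const_mul _ (Kernel.measurable_kernel_prodMk_left hs)]
  refine lintegral_mono fun a => ?_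
  rw [Kernel.prod_apply, Kernel.prod_apply, ← smul_eq_mul, ← Measure.smul_apply,
    ← Measure.prod_smul_right]
  exact Measure.prod_mono le_rfl (hsnd a) _

end InformationDensity

section Spectrum

variable {Ω Ω' : ℕ → Type u} [∀ n, MeasurableSpace (Ω n)] [∀ n, MeasurableSpace (Ω' n)]
  {μ : ∀ n, Measure (Ω n)} {μ' : ∀ n, Measure (Ω' n)} {Z : ∀ n, Ω n → EReal}
  {Z' : ∀ n, Ω' n → EReal} {ι : Type*} [Fintype ι]

theorem tendsto_measure_lt_of_lt_pLiminf {b : EReal} (hb : b < pLiminf μ Z) :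
    Tendsto (fun n => μ n {ω | Z n ω < b}) atTop (𝓝 0) := by
  obtain ⟨c, hc, hbc⟩ := lt_sSup_iff.1 hb
  exact tendsto_of_tendsto_of_tendsto_of_le_of_le tendsto_const_nhds hc (fun _ => zero_le)
    fun n => measure_mono fun ω (hω : _ < _) => hω.trans hbc

theorem tendsto_measure_gt_of_pLimsup_lt {a : EReal} (ha : pLimsup μ Z < a) :
    Tendsto (fun n => μ n {ω | a < Z n ω}) atTop (𝓝 0) := by
  obtain ⟨c, hc, hca⟩ := sInf_lt_iff.1 ha
  exact tendsto_of_tendsto_of_tendsto_of_le_of_le tendsto_const_nhds hc (fun _ => zero_le)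
    fun n => measure_mono fun ω (hω : _ < _) => hca.trans hω

theorem pLiminf_le_pLiminf
    (h : ∀ b b' : ℝ, b < b' → ∃ e : ℕ → ℝ≥0∞, Tendsto e atTop (𝓝 0) ∧
      ∀ᶠ n in atTop, μ n {ω | Z n ω < b} ≤ μ' n {ω | Z' n ω < b'} + e n) :
    pLiminf μ' Z' ≤ pLiminf μ Z := by
  refine EReal.ge_of_forall_gt_iff_ge.1 fun b hb => ?_
  obtain ⟨b', hbb', hb'⟩ := EReal.lt_iff_exists_real_btwn.1 hb
  obtain ⟨e, he, hle⟩ := h b b' (by exact_mod_cast hbb')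
  have hbound := (tendsto_measure_lt_of_lt_pLiminf hb').add he
  rw [add_zero] at hbound
  exact le_sSup (tendsto_of_tendsto_of_tendsto_of_le_of_le' tendsto_const_nhds hbound
    (.of_forall fun _ => zero_le) hle)

theorem pLimsup_le_pLimsup
    (h : ∀ a a' : ℝ, a' < a →
      ∀ᶠ n in atTop, μ n {ω | a < Z n ω} ≤ μ' n {ω | a' < Z' n ω}) :
    pLimsup μ Z ≤ pLimsup μ' Z' := by
  refine EReal.le_of_forall_lt_iff_le.1 fun a ha => ?_
  obtain ⟨a', ha', haa'⟩ := EReal.lt_iff_exists_real_btwn.1 ha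
  exact sInf_le (tendsto_of_tendsto_of_tendsto_of_le_of_le' tendsto_const_nhds
    (tendsto_measure_gt_of_pLimsup_lt ha') (.of_forall fun _ => zero_le)
    (h a a' (by exact_mod_cast haa')))

theorem tendsto_sum_mul_of_tendsto_zero {w : ι → ℝ≥0} {f : ι → ℕ → ℝ≥0∞}
    (hf : ∀ i, w i ≠ 0 → Tendsto (f i) atTop (𝓝 0)) :
    Tendsto (fun n => ∑ i, w i * f i n) atTop (𝓝 0) := by
  rw [← Finset.sum_const_zero (s := Finset.univ (α := ι))]
  refine tendsto_finsetSum _ fun i _ => ?_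
  by_cases h0 : w i = 0
  · simp [h0]
  · simpa using ENNReal.Tendsto.const_mul (hf i h0) (.inr ENNReal.coe_ne_top)

theorem le_pLiminf_of_sum {w : ι → ℝ≥0} {ν : ι → ∀ n, Measure (Ω n)}
    (hμ : ∀ n, μ n = ∑ i, (w i : ℝ≥0∞) • ν i n) {x : EReal}
    (hx : ∀ i, w i ≠ 0 → x ≤ pLiminf (ν i) Z) : x ≤ pLiminf μ Z := by
  refine EReal.ge_of_forall_gt_iff_ge.1 fun b hb => le_sSup ?_
  simpa [hμ] using tendsto_sum_mul_of_tendsto_zero fun i hi =>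
    tendsto_measure_lt_of_lt_pLiminf (hb.trans_le (hx i hi))

theorem pLimsup_le_of_sum {w : ι → ℝ≥0} {ν : ι → ∀ n, Measure (Ω n)}
    (hμ : ∀ n, μ n = ∑ i, (w i : ℝ≥0∞) • ν i n) {x : EReal}
    (hx : ∀ i, w i ≠ 0 → pLimsup (ν i) Z ≤ x) : pLimsup μ Z ≤ x := by
  refine EReal.le_of_forall_lt_iff_le.1 fun a ha => sInf_le ?_
  simpa [hμ] using tendsto_sum_mul_of_tendsto_zero fun i hi =>
    tendsto_measure_gt_of_pLimsup_lt ((hx i hi).trans_lt ha)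

theorem pLiminf_le_of_ae_le [∀ n, IsProbabilityMeasure (μ n)] {x : EReal}
    (h : ∀ n, ∀ᵐ ω ∂μ n, Z n ω ≤ x) : pLiminf μ Z ≤ x := by
  refine sSup_le fun b hb => not_lt.1 fun hxb => zero_ne_one (tendsto_nhds_unique hb ?_)
  have hone : ∀ n, μ n {ω | Z n ω < b} = 1 := fun n =>
    (measure_congr (eventuallyEq_univ.2 ((h n).mono fun _ hω => hω.trans_lt hxb))).trans
      measure_univ
  simpa only [hone] using tendsto_const_nhds

theorem le_pLimsup_of_ae_le [∀ n, IsProbabilityMeasure (μ n)] {x : EReal}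
    (h : ∀ n, ∀ᵐ ω ∂μ n, x ≤ Z n ω) : x ≤ pLimsup μ Z := by
  refine le_sInf fun a ha => not_lt.1 fun hax => zero_ne_one (tendsto_nhds_unique ha ?_)
  have hone : ∀ n, μ n {ω | a < Z n ω} = 1 := fun n =>
    (measure_congr (eventuallyEq_univ.2 ((h n).mono fun _ hω => hax.trans_le hω))).trans
      measure_univ
  simpa only [hone] using tendsto_const_nhds

end Spectrum

section Rates

theorem log_ofReal_exp (x : ℝ) : ENNReal.log (ENNReal.ofReal (Real.exp x)) = x := by
  rw [ENNReal.log_ofReal_of_pos (Real.exp_pos _), Real.log_exp]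

theorem scaled_log_lt_iff {n : ℕ} (hn : n ≠ 0) (r : ℝ≥0∞) (b : ℝ) :
    ((1 / n : ℝ) : EReal) * ENNReal.log r < b ↔ r < ENNReal.ofReal (Real.exp (n * b)) := by
  have hn0 : (0 : ℝ) < n := by positivity
  rw [← ENNReal.log_lt_log_iff, log_ofReal_exp, one_div, EReal.coe_inv, mul_comm,
    ← div_eq_mul_inv, EReal.div_lt_iff (by exact_mod_cast hn0) (EReal.coe_ne_top _),
    mul_comm (n : ℝ), EReal.coe_mul]

theorem lt_scaled_log_iff {n : ℕ} (hn : n ≠ 0) (r : ℝ≥0∞) (b : ℝ) :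
    (b : EReal) < ((1 / n : ℝ) : EReal) * ENNReal.log r ↔
      ENNReal.ofReal (Real.exp (n * b)) < r := by
  have hn0 : (0 : ℝ) < n := by positivity
  rw [← ENNReal.log_lt_log_iff, log_ofReal_exp, one_div, EReal.coe_inv, mul_comm,
    ← div_eq_mul_inv, EReal.lt_div_iff (by exact_mod_cast hn0) (EReal.coe_ne_top _),
    mul_comm (n : ℝ), EReal.coe_mul]

theorem tendsto_ofReal_exp_neg {γ : ℝ} (hγ : 0 < γ) :
    Tendsto (fun n : ℕ => ENNReal.ofReal (Real.exp (-(n * γ)))) atTop (𝓝 0) := by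
  rw [← ENNReal.ofReal_zero]
  exact ENNReal.tendsto_ofReal (Real.tendsto_exp_neg_atTop_nhds_zero.comp
    (tendsto_natCast_atTop_atTop.atTop_mul_const hγ))

theorem eventually_ofReal_exp_lt_mul {a b : ℝ} (hab : a < b) {w : ℝ≥0∞} (hw : w ≠ 0) :
    ∀ᶠ n : ℕ in atTop,
      ENNReal.ofReal (Real.exp (n * a)) < w * ENNReal.ofReal (Real.exp (n * b)) := by
  filter_upwards [(tendsto_ofReal_exp_neg (sub_pos.2 hab)).eventually_lt_const
    (pos_iff_ne_zero.2 hw)] with n hn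
  have hpos : ENNReal.ofReal (Real.exp (n * b)) ≠ 0 := by simp [Real.exp_pos]
  calc ENNReal.ofReal (Real.exp (n * a))
      = ENNReal.ofReal (Real.exp (-(n * (b - a)))) * ENNReal.ofReal (Real.exp (n * b)) := by
        rw [← ENNReal.ofReal_mul (Real.exp_pos _).le, ← Real.exp_add]
        congr 2; ring
    _ < w * ENNReal.ofReal (Real.exp (n * b)) :=
        ENNReal.mul_lt_mul_left hpos ENNReal.ofReal_ne_top hn

variable {α β γ : ℕ → Type u} [∀ n, MeasurableSpace (α n)] [∀ n, MeasurableSpace (β n)]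
  [∀ n, MeasurableSpace (γ n)] {ι : Type*} [Fintype ι]

theorem infMutualInfoRate_le_pLiminf_infoDensity {w : ℝ≥0∞} (hw : w ≠ 0)
    {P P' : ∀ n, Measure (α n × β n)} [∀ n, IsProbabilityMeasure (P n)]
    [∀ n, IsProbabilityMeasure (P' n)] (hP : ∀ n, w • P' n ≤ P n) :
    infMutualInfoRate P' ≤
      pLiminf P' fun n q => ((1 / n : ℝ) : EReal) * infoDensity (P n) q := by
  refine pLiminf_le_pLiminf fun b b' hbb' => ?_
  obtain ⟨γ, hγ, hγb⟩ : ∃ γ : ℝ, 0 < γ ∧ b + (γ + γ) < b' :=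
    ⟨(b' - b) / 4, by linarith, by linarith⟩
  have hE := tendsto_ofReal_exp_neg hγ
  refine ⟨_, by simpa using hE.add hE, ?_⟩
  filter_upwards [eventually_ne_atTop 0, eventually_ofReal_exp_lt_mul hγb hw] with n hn hlt
  have hexp : ENNReal.ofReal (Real.exp (n * b)) *
      (ENNReal.ofReal (Real.exp (n * γ)) * ENNReal.ofReal (Real.exp (n * γ))) =
        ENNReal.ofReal (Real.exp (n * (b + (γ + γ)))) := by
    simp only [← ENNReal.ofReal_mul (Real.exp_pos _).le, ← Real.exp_add, mul_add]
  have hcmp := measure_likelihoodRatio_prod_lt_le (P n) (P' n) (hP n) ENNReal.ofReal_ne_top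
    ENNReal.ofReal_ne_top (hexp.trans_lt hlt)
  rw [← ENNReal.ofReal_inv_of_pos (Real.exp_pos _), ← Real.exp_neg] at hcmp
  simpa only [infoDensity, scaled_log_lt_iff hn] using hcmp

theorem pLimsup_condInfoDensity_le_supCondMutualInfoRate {w : ℝ≥0∞} (hw : w ≠ 0)
    (μ : ∀ n, Measure (α n)) [∀ n, IsProbabilityMeasure (μ n)] {κ κ' : ∀ n, Kernel (α n) (β n)}
    [∀ n, IsMarkovKernel (κ n)] [∀ n, IsMarkovKernel (κ' n)] (hκ : ∀ n a, w • κ' n a ≤ κ n a)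
    (η : ∀ n, Kernel (α n × β n) (γ n)) [∀ n, IsMarkovKernel (η n)] :
    (pLimsup (fun n => μ n ⊗ₘ (κ' n ⊗ₖ η n)) fun n q =>
        ((1 / n : ℝ) : EReal) * condInfoDensity (μ n) (κ n ⊗ₖ η n) q) ≤
      supCondMutualInfoRate μ fun n => κ' n ⊗ₖ η n := by
  refine pLimsup_le_pLimsup fun a a' haa' => ?_
  filter_upwards [eventually_ne_atTop 0, eventually_ofReal_exp_lt_mul haa' hw] with n hn hlt
  simpa only [condInfoDensity, lt_scaled_log_iff hn] using
    measure_lt_likelihoodRatio_condProd_le (μ n) (κ n) (κ' n) (η n) hw (hκ n)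
      ENNReal.ofReal_ne_top (hlt.trans_eq (mul_comm _ _))

theorem iInf_infMutualInfoRate_le {w : ι → ℝ≥0} {P : ∀ n, Measure (α n × β n)}
    {P' : ι → ∀ n, Measure (α n × β n)} [∀ n, IsProbabilityMeasure (P n)]
    [∀ i n, IsProbabilityMeasure (P' i n)] (hP : ∀ n, P n = ∑ i, (w i : ℝ≥0∞) • P' i n) :
    ⨅ i, infMutualInfoRate (P' i) ≤ infMutualInfoRate P :=
  le_pLiminf_of_sum hP fun i hi => (iInf_le _ i).trans <|
    infMutualInfoRate_le_pLiminf_infoDensity (ENNReal.coe_ne_zero.2 hi) fun n =>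
      (hP n).symm ▸ smul_le_sum_smul w (fun i => P' i n) i

theorem supCondMutualInfoRate_le_iSup {w : ι → ℝ≥0} (μ : ∀ n, Measure (α n))
    [∀ n, IsProbabilityMeasure (μ n)] {κ : ∀ n, Kernel (α n) (β n)}
    {κ' : ι → ∀ n, Kernel (α n) (β n)} [∀ n, IsMarkovKernel (κ n)]
    [∀ i n, IsMarkovKernel (κ' i n)] (hκ : ∀ n, IsMixture w (fun i => κ' i n) (κ n))
    (η : ∀ n, Kernel (α n × β n) (γ n)) [∀ n, IsMarkovKernel (η n)] :
    supCondMutualInfoRate μ (fun n => κ n ⊗ₖ η n) ≤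
      ⨆ i, supCondMutualInfoRate μ fun n => κ' i n ⊗ₖ η n :=
  pLimsup_le_of_sum (fun n => ((hκ n).compProd_right (η n)).measure_compProd (μ n)) fun i hi =>
    (pLimsup_condInfoDensity_le_supCondMutualInfoRate (ENNReal.coe_ne_zero.2 hi) μ
      (fun n a => (hκ n).smul_le i a) η).trans (le_iSup_of_le i le_rfl)

theorem infMutualInfoRate_nonpos_of_prod_eq {P : ∀ n, Measure (α n × β n)}
    [∀ n, IsProbabilityMeasure (P n)] (hP : ∀ n, (P n).fst.prod (P n).snd = P n) :
    infMutualInfoRate P ≤ 0 :=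
  pLiminf_le_of_ae_le fun n => by
    filter_upwards [likelihoodRatio_self_ae_eq_one (P n)] with q hq
    rw [infoDensity, hP, hq, ENNReal.log_one, mul_zero]

theorem supCondMutualInfoRate_nonneg_of_prod_eq (μ : ∀ n, Measure (α n))
    [∀ n, IsProbabilityMeasure (μ n)] {κ : ∀ n, Kernel (α n) (β n × γ n)}
    [∀ n, IsMarkovKernel (κ n)] (hκ : ∀ n, (κ n).fst ×ₖ (κ n).snd = κ n) :
    0 ≤ supCondMutualInfoRate μ κ :=
  le_pLimsup_of_ae_le fun n => by
    filter_upwards [likelihoodRatio_self_ae_eq_one (μ n ⊗ₘ κ n)] with q hq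
    rw [condInfoDensity, hκ, hq, ENNReal.log_one, mul_zero]

end Rates

section Limsup

theorem limsup_add_le_limsup_add_limsup {α : Type*} (f : Filter α) (u v : α → ℝ≥0∞) :
    limsup (u + v) f ≤ limsup u f + limsup v f := by
  refine ENNReal.le_of_forall_pos_le_add fun ε hε hfin => ?_
  have hε' : (ε / 2 : ℝ≥0∞) ≠ 0 := by simpa using hε.ne'
  obtain ⟨hu, hv⟩ := ENNReal.add_lt_top.1 hfin
  refine limsup_le_of_le (h := ?_)
  filter_upwards [eventually_lt_of_limsup_lt (ENNReal.lt_add_right hu.ne hε'),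
    eventually_lt_of_limsup_lt (ENNReal.lt_add_right hv.ne hε')] with n hun hvn
  refine (add_le_add hun.le hvn.le).trans_eq ?_
  rw [add_add_add_comm, ENNReal.add_halves]

theorem limsup_sum_mul_le {ι α : Type*} [Fintype ι] (f : Filter α) (w : ι → ℝ≥0)
    (u : ι → α → ℝ≥0∞) :
    limsup (fun a => ∑ i, (w i : ℝ≥0∞) * u i a) f ≤ ∑ i, (w i : ℝ≥0∞) * limsup (u i) f :=
  calc limsup (fun a => ∑ i, (w i : ℝ≥0∞) * u i a) f
      = limsup (∑ i, fun a => (w i : ℝ≥0∞) * u i a) f := by simp only [Finset.sum_fn]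
    _ ≤ ∑ i, limsup (fun a => (w i : ℝ≥0∞) * u i a) f :=
        Finset.le_sum_of_subadditive (limsup · f) limsup_const_bot.le
          (limsup_add_le_limsup_add_limsup f) _ _
    _ = ∑ i, (w i : ℝ≥0∞) * limsup (u i) f :=
        Finset.sum_congr rfl fun _ _ => ENNReal.limsup_const_mul_of_ne_top ENNReal.coe_ne_top

end Limsup

section Model

variable {𝒜 𝒳 𝒮e 𝒮 𝒮d 𝒴 𝒵 𝒮hat : Type u}
  [MeasurableSpace 𝒜] [MeasurableSpace 𝒳] [MeasurableSpace 𝒮e] [MeasurableSpace 𝒮]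
  [MeasurableSpace 𝒮d] [MeasurableSpace 𝒴] [MeasurableSpace 𝒵] [MeasurableSpace 𝒮hat]

namespace InputProcess

variable (p : InputProcess 𝒜 𝒳 𝒮e 𝒵 𝒮hat) (Q : StateLaw 𝒜 𝒮e 𝒮 𝒮d)
  (W : Channel 𝒳 𝒮 𝒴 𝒵) (n : ℕ)

/-- The conditional law of `(S_e^n, S^n, S_d^n, U^n, X^n, Y^n, Z^n)` given `A^n`, nested as in
`Outcome`: it splits `P_{A^n}` off `jointLaw`, leaving a kernel that depends on the model. -/
noncomputable def condJointLaw : Kernel (Seq n 𝒜)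
    ((((Seq n 𝒮e × Seq n 𝒮 × Seq n 𝒮d) × Seq n p.𝒰) × Seq n 𝒳) × (Seq n 𝒴 × Seq n 𝒵)) :=
  ((Q n ⊗ₖ (p.lawU n).comap (fun q => (q.1, q.2.1)) (by fun_prop))
    ⊗ₖ (p.lawX n).comap (fun q => (q.2.2, q.2.1.1)) (by fun_prop))
    ⊗ₖ (W n).comap (fun q => (q.2.2, q.2.1.1.2.1)) (by fun_prop)

theorem jointLaw_eq_compProd : p.jointLaw Q W n = p.lawA n ⊗ₘ p.condJointLaw Q W n := rfl

variable [∀ n, IsMarkovKernel (Q n)] [∀ n, IsMarkovKernel (W n)]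

instance : IsMarkovKernel (p.condJointLaw Q W n) := by
  unfold condJointLaw; infer_instance

instance : IsProbabilityMeasure (p.lawAUSdY Q W n) := by
  have : IsProbabilityMeasure (p.jointLaw Q W n) := by
    rw [jointLaw_eq_compProd]; infer_instance
  exact Measure.isProbabilityMeasure_map (by fun_prop)

instance : IsMarkovKernel (p.condLawSeU Q n) := by
  unfold condLawSeU; infer_instance

theorem lintegral_condJointLaw (a : Seq n 𝒜)
    {f : (((Seq n 𝒮e × Seq n 𝒮 × Seq n 𝒮d) × Seq n p.𝒰) × Seq n 𝒳) × (Seq n 𝒴 × Seq n 𝒵) → ℝ≥0∞}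
    (hf : Measurable f) :
    ∫⁻ ω, f ω ∂(p.condJointLaw Q W n a) =
      ∫⁻ s, ∫⁻ u, ∫⁻ x, ∫⁻ y, f (((s, u), x), y) ∂(W n (x, s.2.1))
        ∂(p.lawX n (u, s.1)) ∂(p.lawU n (a, s.1)) ∂(Q n a) := by
  have hWf : Measurable fun q : ((Seq n 𝒮e × Seq n 𝒮 × Seq n 𝒮d) × Seq n p.𝒰) × Seq n 𝒳 =>
      ∫⁻ y, f (q, y) ∂(W n (q.2, q.1.1.2.1)) :=
    hf.lintegral_kernel_prod_right' (κ := (W n).comap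
      (fun q : ((Seq n 𝒮e × Seq n 𝒮 × Seq n 𝒮d) × Seq n p.𝒰) × Seq n 𝒳 => (q.2, q.1.1.2.1))
      (by fun_prop))
  have hXf : Measurable fun q : (Seq n 𝒮e × Seq n 𝒮 × Seq n 𝒮d) × Seq n p.𝒰 =>
      ∫⁻ x, ∫⁻ y, f ((q, x), y) ∂(W n (x, q.1.2.1)) ∂(p.lawX n (q.2, q.1.1)) :=
    hWf.lintegral_kernel_prod_right' (κ := (p.lawX n).comap
      (fun q : (Seq n 𝒮e × Seq n 𝒮 × Seq n 𝒮d) × Seq n p.𝒰 => (q.2, q.1.1)) (by fun_prop))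
  calc ∫⁻ ω, f ω ∂(p.condJointLaw Q W n a) = _ := Kernel.lintegral_compProd _ _ _ hf
    _ = _ := Kernel.lintegral_compProd _ _ _ hWf
    _ = _ := Kernel.lintegral_compProd _ _ _ hXf

section Mixture

variable {ι κ : Type*} [Fintype ι] [Fintype κ] {α : ι → ℝ≥0} {β : κ → ℝ≥0}
  {Q : StateLaw 𝒜 𝒮e 𝒮 𝒮d} [∀ n, IsMarkovKernel (Q n)] {Q' : ι → StateLaw 𝒜 𝒮e 𝒮 𝒮d}
  [∀ i n, IsMarkovKernel (Q' i n)] {W : Channel 𝒳 𝒮 𝒴 𝒵} [∀ n, IsMarkovKernel (W n)]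
  {W' : κ → Channel 𝒳 𝒮 𝒴 𝒵} [∀ j n, IsMarkovKernel (W' j n)]
  (hQ : ∀ n, IsMixture α (fun i => Q' i n) (Q n)) (hW : ∀ n, IsMixture β (fun j => W' j n) (W n))

include hQ hW

theorem isMixture_condJointLaw (n : ℕ) :
    IsMixture (fun k : ι × κ => α k.1 * β k.2)
      (fun k => p.condJointLaw (Q' k.1) (W' k.2) n) (p.condJointLaw Q W n) := by
  unfold condJointLaw
  exact (((hQ n).compProd_right _).compProd_right _).compProd ((hW n).comap _)

theorem jointLaw_eq_sum (n : ℕ) :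
    p.jointLaw Q W n =
      ∑ k : ι × κ, ((α k.1 * β k.2 : ℝ≥0) : ℝ≥0∞) • p.jointLaw (Q' k.1) (W' k.2) n :=
  (p.isMixture_condJointLaw hQ hW n).measure_compProd (p.lawA n)

theorem lawAUSdY_eq_sum (n : ℕ) :
    p.lawAUSdY Q W n =
      ∑ k : ι × κ, ((α k.1 * β k.2 : ℝ≥0) : ℝ≥0∞) • p.lawAUSdY (Q' k.1) (W' k.2) n := by
  have hm : Measurable fun ω : p.Outcome 𝒮 𝒮d 𝒴 n =>
      ((ω.1, ω.2.1.1.2), (ω.2.1.1.1.2.2, ω.2.2.1)) := by fun_prop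
  ext s hs
  simp only [lawAUSdY, Measure.map_apply hm hs, Measure.finsetSum_apply, Measure.smul_apply,
    p.jointLaw_eq_sum hQ hW]

theorem iInf_infRate_le : ⨅ i, ⨅ j, p.infRate (Q' i) (W' j) ≤ p.infRate Q W := by
  rw [← iInf_prod (f := fun k : ι × κ => p.infRate (Q' k.1) (W' k.2))]
  exact iInf_infMutualInfoRate_le (p.lawAUSdY_eq_sum hQ hW)

theorem avgDistortion_le_sum (d : ∀ n, Seq n 𝒮 × Seq n 𝒮hat → ℝ≥0) :
    p.avgDistortion d Q W ≤
      ∑ i, ∑ j, (α i : ℝ≥0∞) * (β j : ℝ≥0∞) * p.avgDistortion d (Q' i) (W' j) := by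
  have hn : ∀ n, (∫⁻ ω, d n (ω.2.1.1.1.2.1, p.g n (ω.2.1.2, ω.1, ω.2.1.1.1.1, ω.2.2.2))
      ∂p.jointLaw Q W n) / n = ∑ k : ι × κ, ((α k.1 * β k.2 : ℝ≥0) : ℝ≥0∞) *
        ((∫⁻ ω, d n (ω.2.1.1.1.2.1, p.g n (ω.2.1.2, ω.1, ω.2.1.1.1.1, ω.2.2.2))
          ∂p.jointLaw (Q' k.1) (W' k.2) n) / n) := fun n => by
    simp_rw [p.jointLaw_eq_sum hQ hW, lintegral_finsetSum_measure, lintegral_smul_measure,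
      smul_eq_mul, div_eq_mul_inv, Finset.sum_mul, mul_assoc]
  calc p.avgDistortion d Q W
      ≤ ∑ k : ι × κ, ((α k.1 * β k.2 : ℝ≥0) : ℝ≥0∞) * p.avgDistortion d (Q' k.1) (W' k.2) := by
        unfold avgDistortion
        simp_rw [hn]
        exact limsup_sum_mul_le atTop _ _
    _ = ∑ i, ∑ j, (α i : ℝ≥0∞) * (β j : ℝ≥0∞) * p.avgDistortion d (Q' i) (W' j) := by
        simp_rw [ENNReal.coe_mul, Fintype.sum_prod_type]

omit hW in
theorem supRate_le_iSup : p.supRate Q ≤ ⨆ i, p.supRate (Q' i) :=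
  supCondMutualInfoRate_le_iSup p.lawA (fun n => (hQ n).fst) p.lawU

end Mixture

end InputProcess

/-- The counterpart of `mixedDistortionBound` for mixtures of finitely many state distributions
and finitely many channels. -/
noncomputable def finiteMixtureBound {ι κ : Type*} [Fintype ι] [Fintype κ]
    (d : ∀ n, Seq n 𝒮 × Seq n 𝒮hat → ℝ≥0) (α : ι → ℝ≥0) (β : κ → ℝ≥0)
    (Q : ι → StateLaw 𝒜 𝒮e 𝒮 𝒮d) (W : κ → Channel 𝒳 𝒮 𝒴 𝒵) (C : ℝ) : ℝ≥0∞ :=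
  ⨆ (p : InputProcess 𝒜 𝒳 𝒮e 𝒵 𝒮hat)
    (_ : (⨅ i, ⨅ j, p.infRate (Q i) (W j)) - (⨆ i, p.supRate (Q i)) ≤ (C : EReal)),
    ∑ i, ∑ j, (α i : ℝ≥0∞) * (β j : ℝ≥0∞) * p.avgDistortion d (Q i) (W j)

theorem distortionCapacity_le_finiteMixtureBound {ι κ : Type*} [Fintype ι] [Fintype κ]
    (d : ∀ n, Seq n 𝒮 × Seq n 𝒮hat → ℝ≥0) {α : ι → ℝ≥0} {β : κ → ℝ≥0}
    {Q : StateLaw 𝒜 𝒮e 𝒮 𝒮d} [∀ n, IsMarkovKernel (Q n)]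
    {Q' : ι → StateLaw 𝒜 𝒮e 𝒮 𝒮d} [∀ i n, IsMarkovKernel (Q' i n)]
    {W : Channel 𝒳 𝒮 𝒴 𝒵} [∀ n, IsMarkovKernel (W n)]
    {W' : κ → Channel 𝒳 𝒮 𝒴 𝒵} [∀ j n, IsMarkovKernel (W' j n)]
    (hQ : ∀ n, IsMixture α (fun i => Q' i n) (Q n))
    (hW : ∀ n, IsMixture β (fun j => W' j n) (W n)) (C : ℝ) :
    distortionCapacity d Q W C ≤ finiteMixtureBound d α β Q' W' C :=
  iSup₂_le fun p hp => le_iSup₂_of_le p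
    ((EReal.sub_le_sub (p.iInf_infRate_le hQ hW) (p.supRate_le_iSup hQ)).trans hp)
    (p.avgDistortion_le_sum hQ hW d)

namespace Code

section Message

variable {n : ℕ} (c : Code 𝒜 𝒳 𝒮e 𝒮d 𝒴 𝒵 𝒮hat n) (d : ∀ n, Seq n 𝒮 × Seq n 𝒮hat → ℝ≥0)
  (Q : StateLaw 𝒜 𝒮e 𝒮 𝒮d) (W : Channel 𝒳 𝒮 𝒴 𝒵)

/-- The (unnormalized) expected distortion of a code, given that the message `m` is sent. -/
noncomputable def messageDistortion (m : Fin c.M) : ℝ≥0∞ :=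
  ∫⁻ s, ∫⁻ y, (d n (s.2.1, c.g (c.f m s.1, c.fA m, s.1, y.2)) : ℝ≥0∞)
    ∂(W n (c.f m s.1, s.2.1)) ∂(Q n (c.fA m))

theorem exists_expectedDistortion_le_messageDistortion :
    ∃ m, c.expectedDistortion d Q W ≤ c.messageDistortion d Q W m := by
  obtain ⟨m, -, hm⟩ := Finset.exists_max_image Finset.univ (c.messageDistortion d Q W)
    ⟨⟨0, c.M_pos⟩, Finset.mem_univ _⟩
  refine ⟨m, ENNReal.div_le_of_le_mul' ?_⟩
  have h := Finset.sum_le_card_nsmul _ _ _ hm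
  rwa [Finset.card_univ, Fintype.card_fin, nsmul_eq_mul] at h

end Message

section MessageProcess

variable (c : ∀ n, Code 𝒜 𝒳 𝒮e 𝒮d 𝒴 𝒵 𝒮hat n) (m : ∀ n, Fin (c n).M)

/-- The process obtained from a sequence of codes by always sending the messages `m n`. The
auxiliary alphabet is a single point, so that the process carries no information. -/
noncomputable def messageProcess : InputProcess 𝒜 𝒳 𝒮e 𝒵 𝒮hat where
  𝒰 := PUnit
  lawA n := Measure.dirac ((c n).fA (m n))
  lawU _ := Kernel.const _ (Measure.dirac fun _ => PUnit.unit)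
  lawX n := Kernel.deterministic (fun q => (c n).f (m n) q.2)
    (((c n).measurable_f (m n)).comp measurable_snd)
  g n := (c n).g
  measurable_g n := (c n).measurable_g

instance (n : ℕ) : Subsingleton (Seq n (messageProcess c m).𝒰) :=
  inferInstanceAs (Subsingleton (Fin n → PUnit))

theorem jointLaw_messageProcess (Q : StateLaw 𝒜 𝒮e 𝒮 𝒮d) (W : Channel 𝒳 𝒮 𝒴 𝒵) (n : ℕ) :
    (messageProcess c m).jointLaw Q W n =
      ((messageProcess c m).condJointLaw Q W n ((c n).fA (m n))).map
        (Prod.mk ((c n).fA (m n))) :=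
  dirac_compProd_eq_map _ _

theorem supRate_messageProcess_nonneg (Q : StateLaw 𝒜 𝒮e 𝒮 𝒮d) [∀ n, IsMarkovKernel (Q n)] :
    0 ≤ (messageProcess c m).supRate Q := by
  refine supCondMutualInfoRate_nonneg_of_prod_eq _ fun n => ?_
  rw [InputProcess.condLawSeU, Kernel.fst_compProd, prod_eq_compProd_prodMkRight]
  congr 1
  ext1 q
  exact eq_of_isProbabilityMeasure_of_subsingleton _ _

variable (Q : StateLaw 𝒜 𝒮e 𝒮 𝒮d) [∀ n, IsMarkovKernel (Q n)]
  (W : Channel 𝒳 𝒮 𝒴 𝒵) [∀ n, IsMarkovKernel (W n)]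

theorem infRate_messageProcess_nonpos : (messageProcess c m).infRate Q W ≤ 0 := by
  refine infMutualInfoRate_nonpos_of_prod_eq fun n => ?_
  set p := messageProcess c m
  set a := (c n).fA (m n)
  let u : Seq n p.𝒰 := fun _ => PUnit.unit
  have hSdY : Measurable fun ω : (((Seq n 𝒮e × Seq n 𝒮 × Seq n 𝒮d) × Seq n p.𝒰) × Seq n 𝒳) ×
      (Seq n 𝒴 × Seq n 𝒵) => (ω.1.1.1.2.2, ω.2.1) := by fun_prop
  have := Measure.isProbabilityMeasure_map (μ := p.condJointLaw Q W n a) hSdY.aemeasurable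
  have hprod : p.lawAUSdY Q W n = (Measure.dirac (a, u)).prod
      ((p.condJointLaw Q W n a).map fun ω => (ω.1.1.1.2.2, ω.2.1)) := by
    rw [InputProcess.lawAUSdY, jointLaw_messageProcess, Measure.dirac_prod,
      Measure.map_map (by fun_prop) measurable_prodMk_left,
      Measure.map_map measurable_prodMk_left hSdY]
    congr 1
  rw [hprod, Measure.fst_prod, Measure.snd_prod]

variable {d : ∀ n, Seq n 𝒮 × Seq n 𝒮hat → ℝ≥0} (hd : ∀ n, Measurable (d n))

include hd

theorem avgDistortion_messageProcess :
    (messageProcess c m).avgDistortion d Q W =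
      limsup (fun n => (c n).messageDistortion d Q W (m n) / n) atTop := by
  unfold InputProcess.avgDistortion
  congr! 3 with n
  set p := messageProcess c m
  have hg : Measurable (p.g n) := p.measurable_g n
  have hf : Measurable fun ω : p.Outcome 𝒮 𝒮d 𝒴 n =>
      (d n (ω.2.1.1.1.2.1, p.g n (ω.2.1.2, ω.1, ω.2.1.1.1.1, ω.2.2.2)) : ℝ≥0∞) := by fun_prop
  rw [jointLaw_messageProcess, lintegral_map hf measurable_prodMk_left]
  refine (p.lintegral_condJointLaw Q W n _ (hf.comp measurable_prodMk_left)).trans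
    (lintegral_congr fun s => ?_)
  have hy : Measurable fun x : Seq n 𝒳 =>
      ∫⁻ y, (d n (s.2.1, p.g n (x, (c n).fA (m n), s.1, y.2)) : ℝ≥0∞) ∂(W n (x, s.2.1)) :=
    Measurable.lintegral_kernel_prod_right'
      (κ := (W n).comap (fun x : Seq n 𝒳 => (x, s.2.1)) (by fun_prop))
      (f := fun q : Seq n 𝒳 × (Seq n 𝒴 × Seq n 𝒵) =>
        (d n (s.2.1, p.g n (q.1, (c n).fA (m n), s.1, q.2.2)) : ℝ≥0∞)) (by fun_prop)
  exact (lintegral_dirac' _ Subsingleton.measurable).trans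
    (Kernel.lintegral_deterministic' (g := fun q : Seq n p.𝒰 × Seq n 𝒮e => (c n).f (m n) q.2)
      (a := (fun _ => PUnit.unit, s.1)) (((c n).measurable_f (m n)).comp measurable_snd) hy)

theorem limsup_expectedDistortion_le_distortionCapacity {C : ℝ} (hC : 0 ≤ C) :
    limsup (fun n => (c n).expectedDistortion d Q W / n) atTop ≤ distortionCapacity d Q W C := by
  choose m hm using fun n => (c n).exists_expectedDistortion_le_messageDistortion d Q W
  have hrate : (messageProcess c m).infRate Q W - (messageProcess c m).supRate Q ≤ (C : EReal) :=
    calc (messageProcess c m).infRate Q W - (messageProcess c m).supRate Q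
        ≤ 0 - 0 := EReal.sub_le_sub (infRate_messageProcess_nonpos c m Q W)
          (supRate_messageProcess_nonneg c m Q)
      _ ≤ (C : EReal) := by rw [sub_zero]; exact_mod_cast hC
  calc limsup (fun n => (c n).expectedDistortion d Q W / n) atTop
      ≤ limsup (fun n => (c n).messageDistortion d Q W (m n) / n) atTop :=
        limsup_le_limsup (.of_forall fun n => ENNReal.div_le_div_right (hm n) _)
    _ = (messageProcess c m).avgDistortion d Q W :=
        (avgDistortion_messageProcess c m Q W hd).symm
    _ ≤ distortionCapacity d Q W C := le_iSup₂_of_le _ hrate le_rfl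

end MessageProcess

end Code

theorem operationalDistortion_le_distortionCapacity {d : ∀ n, Seq n 𝒮 × Seq n 𝒮hat → ℝ≥0}
    (hd : ∀ n, Measurable (d n)) (Q : StateLaw 𝒜 𝒮e 𝒮 𝒮d) [∀ n, IsMarkovKernel (Q n)]
    (W : Channel 𝒳 𝒮 𝒴 𝒵) [∀ n, IsMarkovKernel (W n)] {C : ℝ} (hC : 0 ≤ C)
    (hach : ∃ D : ℝ≥0, AverageAchievable d Q W C D) :
    operationalDistortion d Q W C ≤ distortionCapacity d Q W C := by
  obtain ⟨D, hD⟩ := hach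
  by_cases htop : distortionCapacity d Q W C = ∞
  · exact htop ▸ le_top
  lift distortionCapacity d Q W C to ℝ≥0 using htop with D' hD'
  refine iInf₂_le D' fun ε hε => ?_
  obtain ⟨c, hrate, herr, -⟩ := hD ε hε
  exact ⟨c, hrate, herr,
    hD' ▸ Code.limsup_expectedDistortion_le_distortionCapacity c Q W hd hC⟩

end Model

end ISAC

theorem theorem4_general {𝒜 𝒳 𝒮e 𝒮 𝒮d 𝒴 𝒵 𝒮hat : Type u}
    [MeasurableSpace 𝒜] [MeasurableSpace 𝒳] [MeasurableSpace 𝒮e] [MeasurableSpace 𝒮]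
    [MeasurableSpace 𝒮d] [MeasurableSpace 𝒴] [MeasurableSpace 𝒵] [MeasurableSpace 𝒮hat]
    {ι κ : Type*} [Fintype ι] [Fintype κ]
    (d : ∀ n, ISAC.Seq n 𝒮 × ISAC.Seq n 𝒮hat → ℝ≥0) (hd : ∀ n, Measurable (d n))
    (α : ι → ℝ≥0) (β : κ → ℝ≥0)
    (Q : ISAC.StateLaw 𝒜 𝒮e 𝒮 𝒮d) [∀ n, IsMarkovKernel (Q n)]
    (Q' : ι → ISAC.StateLaw 𝒜 𝒮e 𝒮 𝒮d) [∀ i n, IsMarkovKernel (Q' i n)]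
    (W : ISAC.Channel 𝒳 𝒮 𝒴 𝒵) [∀ n, IsMarkovKernel (W n)]
    (W' : κ → ISAC.Channel 𝒳 𝒮 𝒴 𝒵) [∀ j n, IsMarkovKernel (W' j n)]
    (hQ : ∀ n, ISAC.IsMixture α (fun i => Q' i n) (Q n))
    (hW : ∀ n, ISAC.IsMixture β (fun j => W' j n) (W n)) (C : ℝ) :
    ISAC.distortionCapacity d Q W C ≤ ISAC.finiteMixtureBound d α β Q' W' C ∧
    (0 ≤ C → (∃ D : ℝ≥0, ISAC.AverageAchievable d Q W C D) →
      ISAC.operationalDistortion d Q W C ≤ ISAC.finiteMixtureBound d α β Q' W' C) :=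
  have hbound := ISAC.distortionCapacity_le_finiteMixtureBound d hQ hW C
  ⟨hbound, fun hC hach =>
    (ISAC.operationalDistortion_le_distortionCapacity hd Q W hC hach).trans hbound⟩

theorem theorem4 {𝒜 𝒳 𝒮e 𝒮 𝒮d 𝒴 𝒵 𝒮hat : Type u}
    [MeasurableSpace 𝒜] [MeasurableSpace 𝒳] [MeasurableSpace 𝒮e] [MeasurableSpace 𝒮]
    [MeasurableSpace 𝒮d] [MeasurableSpace 𝒴] [MeasurableSpace 𝒵] [MeasurableSpace 𝒮hat]
    (d : ∀ n, ISAC.Seq n 𝒮 × ISAC.Seq n 𝒮hat → ℝ≥0) (hd : ∀ n, Measurable (d n))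
    (α β : Fin 2 → ℝ≥0) (hα : α 0 + α 1 = 1) (hβ : β 0 + β 1 = 1)
    (Q : Fin 2 → ISAC.StateLaw 𝒜 𝒮e 𝒮 𝒮d) [∀ i n, IsMarkovKernel (Q i n)]
    (W : Fin 2 → ISAC.Channel 𝒳 𝒮 𝒴 𝒵) [∀ j n, IsMarkovKernel (W j n)]
    (C : ℝ) :
    -- the information-spectrum form of the distortion-capacity function, for every `C`
    ISAC.distortionCapacity d (fun n => ISAC.mix α fun i => Q i n)
        (fun n => ISAC.mix β fun j => W j n) C
      ≤ ISAC.mixedDistortionBound d α β Q W C ∧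
    -- its operational form, for every rate `C ≥ 0` at which some distortion is achievable
    (0 ≤ C →
      (∃ D : ℝ≥0, ISAC.AverageAchievable d (fun n => ISAC.mix α fun i => Q i n)
        (fun n => ISAC.mix β fun j => W j n) C D) →
      ISAC.operationalDistortion d (fun n => ISAC.mix α fun i => Q i n)
          (fun n => ISAC.mix β fun j => W j n) C
        ≤ ISAC.mixedDistortionBound d α β Q W C) :=
  have := fun n => ISAC.isMarkovKernel_mix hα fun i => Q i n
  have := fun n => ISAC.isMarkovKernel_mix hβ fun j => W j n
  theorem4_general d hd α β _ Q _ W (fun _ _ => rfl) (fun _ _ => rfl) C
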